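/- Let $k<m$ and $n$ be positive integers, let $X\in\mathbb{R}^{m\times n}$ be a (zero-centered) data matrix, and let $\sigma_1^2>\cdots>\sigma_k^2>0$ be the $k$ largest eigenvalues, counted with multiplicity, of $\frac1n XX^\top$, all the remaining eigenvalues being smaller than $\sigma_k^2$. Let the columns of $U\in\mathbb{R}^{m\times k}$ be corresponding orthonormal eigenvectors, $S=\mathrm{diag}(\sigma_1,\dots,\sigma_k)$, and let $\Lambda=\mathrm{diag}(\lambda_1,\dots,\lambda_k)$ with $0<\lambda_1<\cdots<\lambda_k$. For $W_1\in\mathbb{R}^{k\times m}$ and $W_2\in\mathbb{R}^{m\times k}$ put $$\mathcal{L}(W_1,W_2)=\tfrac1n\|X-W_2W_1X\|_F^2+\|\Lambda^{1/2}W_1\|_F^2+\|W_2\Lambda^{1/2}\|_F^2 .$$ Assume $\lambda_k<\sigma_k^2$. Then $\mathcal{L}$ attains its minimum, and $(W_1,W_2)$ is a global minimum if and only if $$W_1=\tilde I\,(I-\Lambda S^{-2})^{1/2}U^\top,\qquad W_2=W_1^\top=U(I-\Lambda S^{-2})^{1/2}\tilde I$$ for some diagonal matrix $\tilde I\in\mathbb{R}^{k\times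 k}$ with diagonal entries $\pm1$. Every other stationary point of $\mathcal{L}$ is a strict saddle: it is not a local extremum, and the Hessian of $\mathcal{L}$ there has a negative eigenvalue. In particular, every local minimum of $\mathcal{L}$ is a global minimum. -/

import Mathlib

open Matrix

-- Matrices carry the Frobenius norm throughout.
attribute [local instance] Matrix.frobeniusNormedAddCommGroup Matrix.frobeniusNormedSpace

namespace LAE

/-- The weights `(W₁, W₂)` of a linear autoencoder: encoder `k × m`, decoder `m × k`. -/
abbrev Weights (m k : ℕ) : Type :=
  Matrix (Fin k) (Fin m) ℝ × Matrix (Fin m) (Fin k) ℝ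

/-- The empirical covariance matrix `(1/n) X Xᵀ` of the (centred) data `X`. -/
noncomputable def empCov {m n : ℕ} (X : Matrix (Fin m) (Fin n) ℝ) : Matrix (Fin m) (Fin m) ℝ :=
  (1 / (n : ℝ)) • (X * Xᵀ)

/-- The non-uniform `ℓ²`-regularized objective
`(1/n) ‖X - W₂ W₁ X‖² + ‖Λ^{1/2} W₁‖² + ‖W₂ Λ^{1/2}‖²`, with Frobenius norms and
`Λ = diag (lam 0, …, lam (k-1))`. -/
noncomputable def objective {m n k : ℕ} (X : Matrix (Fin m) (Fin n) ℝ) (lam : Fin k → ℝ)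
    (W : Weights m k) : ℝ :=
  (1 / (n : ℝ)) * ‖X - W.2 * W.1 * X‖ ^ 2
    + ‖diagonal (fun i => Real.sqrt (lam i)) * W.1‖ ^ 2
    + ‖W.2 * diagonal (fun i => Real.sqrt (lam i))‖ ^ 2

/-- `σ i ^ 2`, for `i : Fin k`, are the `k` largest eigenvalues of the symmetric matrix `C`,
positive, distinct and in decreasing order, and the columns of `U` are corresponding
orthonormal eigenvectors. -/
structure IsTopEigensystem {m k : ℕ} (C : Matrix (Fin m) (Fin m) ℝ) (U : Matrix (Fin m) (Fin k) ℝ)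
    (σ : Fin k → ℝ) : Prop where
  pos : ∀ i, 0 < σ i ^ 2
  strictAnti : StrictAnti fun i => σ i ^ 2
  orthonormal : Uᵀ * U = 1
  eigen : C * U = U * diagonal fun i => σ i ^ 2
  /-- The remaining eigenvalues of `C` (counted with multiplicity, they are the eigenvalues of `C`
  on the orthogonal complement of the columns of `U`) are smaller. -/
  rest_lt : ∀ (μ : ℝ) (v : Fin m → ℝ), v ≠ 0 → Uᵀ *ᵥ v = 0 → C *ᵥ v = μ • v → ∀ i, μ < σ i ^ 2

/-- The diagonal matrix `(I - Λ S⁻²)^{1/2}`, where `S = diag σ`. -/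
noncomputable def shrink {k : ℕ} (lam σ : Fin k → ℝ) : Matrix (Fin k) (Fin k) ℝ :=
  diagonal fun i => Real.sqrt (1 - lam i / σ i ^ 2)

/-- `W₁ = Ĩ (I - Λ S⁻²)^{1/2} Uᵀ` and `W₂ = U (I - Λ S⁻²)^{1/2} Ĩ` for a diagonal matrix `Ĩ` with
diagonal entries `±1`. -/
def IsOrderedAxisAligned {m k : ℕ} (lam σ : Fin k → ℝ) (U : Matrix (Fin m) (Fin k) ℝ)
    (W : Weights m k) : Prop :=
  ∃ ε : Fin k → ℝ, (∀ i, ε i = 1 ∨ ε i = -1) ∧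
    W.1 = diagonal ε * shrink lam σ * Uᵀ ∧ W.2 = U * shrink lam σ * diagonal ε

/-- A stationary point of a differentiable function. -/
def IsStationary {E : Type*} [NormedAddCommGroup E] [NormedSpace ℝ E] (f : E → ℝ) (p : E) : Prop :=
  DifferentiableAt ℝ f p ∧ fderiv ℝ f p = 0

/-- A strict saddle of a twice differentiable function: a stationary point that is not a local
maximum and at which the Hessian takes a negative value (so that it is not a local minimum
either). -/
def IsStrictSaddle {E : Type*} [NormedAddCommGroup E] [NormedSpace ℝ E] (f : E → ℝ) (p : E) :
    Prop :=
  IsStationary f p ∧ ContDiffAt ℝ 2 f p ∧ ¬ IsLocalMax f p ∧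
    ∃ v : E, fderiv ℝ (fderiv ℝ f) p v v < 0

end LAE

/-! Write `C = empCov X`, `A = W₁`, `B = W₂`. Along every line the objective is a quartic
polynomial, so stationarity and the Hessian form are read off from its coefficients
(`objective_line`); the rest is linear algebra on `slope` and `curvature`.

Stationarity gives one matrix equation for the encoder and one for the decoder. As `lam` is positive
with distinct entries, they force `A Aᵀ = Bᵀ B` and `A C Aᵀ` to be diagonal
(`gram_diagonal_of_slope_eq_zero`). The system then splits into one pair of vector equations per
index, and positive semidefiniteness of `C` yields `B = Aᵀ`, with rows of `A` orthogonal
eigenvectors of `C` or zero (`exists_isEigenEncoder_of_slope_eq_zero`).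

If moreover the curvature is nonnegative, two families of test directions finish the classification.
Turning a row towards an eigenvector orthogonal to all rows shows that no top eigenvector is missed;
mixing two rows shows that larger eigenvalues sit at smaller penalties. Hence row `l` is a multiple
of column `l` of `U`, with length fixed by stationarity
(`isOrderedAxisAligned_of_curvature_nonneg`).

A minimum exists by coercivity and has this form; all points of this form have the same value, so
all are minima. Any other stationary point has a direction of negative curvature, and convexity in
the encoder alone excludes local maxima. -/

namespace LAE

/-! ### Derivatives of functions that are quartic along lines. -/

section Calculus

variable {E : Type*} [NormedAddCommGroup E] [NormedSpace ℝ E] {f : E → ℝ} {p v : E}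

theorem hasDerivAt_line (p v : E) (t : ℝ) : HasDerivAt (fun s : ℝ => p + s • v) v t := by
  simpa using ((hasDerivAt_id t).smul_const v).const_add p

theorem hasDerivAt_quartic (c a₁ a₂ a₃ a₄ t : ℝ) :
    HasDerivAt (fun t : ℝ => c + a₁ * t + a₂ * t ^ 2 + a₃ * t ^ 3 + a₄ * t ^ 4)
      (a₁ + 2 * a₂ * t + 3 * a₃ * t ^ 2 + 4 * a₄ * t ^ 3) t := by
  have h := (((((hasDerivAt_id t).const_mul a₁).const_add c).add
    ((hasDerivAt_pow 2 t).const_mul a₂)).add ((hasDerivAt_pow 3 t).const_mul a₃)).add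
    ((hasDerivAt_pow 4 t).const_mul a₄)
  refine h.congr_deriv ?_
  norm_num
  ring

theorem fderiv_line_of_quartic (hf : Differentiable ℝ f) {a₁ a₂ a₃ a₄ : ℝ}
    (h : ∀ t : ℝ, f (p + t • v) = f p + a₁ * t + a₂ * t ^ 2 + a₃ * t ^ 3 + a₄ * t ^ 4) (t : ℝ) :
    fderiv ℝ f (p + t • v) v = a₁ + 2 * a₂ * t + 3 * a₃ * t ^ 2 + 4 * a₄ * t ^ 3 := by
  have h1 : HasDerivAt (fun s : ℝ => f (p + s • v)) (fderiv ℝ f (p + t • v) v) t :=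
    (hf _).hasFDerivAt.comp_hasDerivAt t (hasDerivAt_line p v t)
  rw [funext h] at h1
  exact h1.unique (hasDerivAt_quartic _ _ _ _ _ t)

theorem fderiv_fderiv_of_quartic (hf : ContDiff ℝ 2 f) {a₁ a₂ a₃ a₄ : ℝ}
    (h : ∀ t : ℝ, f (p + t • v) = f p + a₁ * t + a₂ * t ^ 2 + a₃ * t ^ 3 + a₄ * t ^ 4) :
    fderiv ℝ (fderiv ℝ f) p v v = 2 * a₂ := by
  have hd : Differentiable ℝ (fderiv ℝ f) :=
    (hf.fderiv_right (m := 1) (by norm_num)).differentiable (by norm_num)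
  have h1 : HasDerivAt (fun s : ℝ => fderiv ℝ f (p + s • v))
      (fderiv ℝ (fderiv ℝ f) (p + (0 : ℝ) • v) v) 0 :=
    (hd _).hasFDerivAt.comp_hasDerivAt 0 (hasDerivAt_line p v 0)
  have h2 := h1.clm_apply (hasDerivAt_const (0 : ℝ) v)
  rw [funext (fderiv_line_of_quartic (hf.differentiable (by norm_num)) h)] at h2
  have h3 := hasDerivAt_quartic a₁ (2 * a₂) (3 * a₃) (4 * a₄) 0 0
  simp only [zero_mul, add_zero] at h3
  simpa using h2.unique h3

theorem eventually_line {q : E → Prop} (h : ∀ᶠ x in nhds p, q x) (v : E) :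
    ∀ᶠ t : ℝ in nhdsWithin 0 {0}ᶜ, q (p + t • v) := by
  have hc : Filter.Tendsto (fun t : ℝ => p + t • v) (nhds 0) (nhds p) := by
    have := (hasDerivAt_line p v 0).continuousAt.tendsto
    simpa using this
  exact (hc.mono_left nhdsWithin_le_nhds).eventually h

/-- Divide the increment by `t ^ 2` and let `t` tend to `0`. -/
theorem coeff_two_nonneg_of_isLocalMin (hmin : IsLocalMin f p) {a₁ a₂ a₃ a₄ : ℝ}
    (h : ∀ t : ℝ, f (p + t • v) = f p + a₁ * t + a₂ * t ^ 2 + a₃ * t ^ 3 + a₄ * t ^ 4)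
    (ha : a₁ = 0) : 0 ≤ a₂ := by
  subst ha
  have hc : Filter.Tendsto (fun t : ℝ => a₂ + a₃ * t + a₄ * t ^ 2) (nhdsWithin 0 {0}ᶜ)
      (nhds a₂) := by
    have : ContinuousAt (fun t : ℝ => a₂ + a₃ * t + a₄ * t ^ 2) 0 := by fun_prop
    simpa using this.tendsto.mono_left (nhdsWithin_le_nhds (s := {0}ᶜ))
  refine ge_of_tendsto hc ?_
  filter_upwards [eventually_line hmin v, self_mem_nhdsWithin] with t ht h0
  rw [h t] at ht
  have h2 : 0 < t ^ 2 := by positivity [show t ≠ 0 from h0]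
  by_contra! hn
  nlinarith [mul_pos_of_neg_of_neg hn (neg_neg_of_pos h2)]

theorem not_isLocalMax_of_quadratic {a₂ : ℝ} (ha : 0 < a₂)
    (h : ∀ t : ℝ, f (p + t • v) = f p + a₂ * t ^ 2) : ¬ IsLocalMax f p := by
  intro hmax
  obtain ⟨t, ht, h0⟩ := ((eventually_line hmax v).and self_mem_nhdsWithin).exists
  rw [h t] at ht
  have : 0 < a₂ * t ^ 2 := mul_pos ha (by have : t ≠ 0 := h0; positivity)
  linarith

theorem isStationary_iff_of_quartic (hf : ContDiff ℝ 2 f) {a₁ a₂ a₃ a₄ : E → ℝ}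
    (h : ∀ v, ∀ t : ℝ,
      f (p + t • v) = f p + a₁ v * t + a₂ v * t ^ 2 + a₃ v * t ^ 3 + a₄ v * t ^ 4) :
    IsStationary f p ↔ ∀ v, a₁ v = 0 := by
  have hd := hf.differentiable (by norm_num)
  have key (v : E) : fderiv ℝ f p v = a₁ v := by
    simpa using fderiv_line_of_quartic hd (h v) 0
  constructor
  · intro hs v
    rw [← key v, hs.2]
    simp
  · intro hs
    exact ⟨hd p, ContinuousLinearMap.ext fun v => by simp [key, hs]⟩

theorem contDiff_linearMap [FiniteDimensional ℝ E] (L : E →ₗ[ℝ] ℝ) : ContDiff ℝ 2 fun x => L x :=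
  (LinearMap.toContinuousLinearMap L).contDiff

theorem isStationary_of_isLocalMin (hf : ContDiff ℝ 2 f) (h : IsLocalMin f p) : IsStationary f p :=
  ⟨hf.differentiable (by norm_num) p, h.fderiv_eq_zero⟩

end Calculus

/-- A continuous function that dominates `c ‖x‖ ^ 2` attains its minimum. -/
theorem exists_isMinOn_of_coercive {E : Type*} [NormedAddCommGroup E] [ProperSpace E]
    {f : E → ℝ} (hf : Continuous f) {c : ℝ} (hc : 0 < c)
    (h : ∀ x, c * ‖x‖ ^ 2 ≤ f x) : ∃ x, IsMinOn f Set.univ x := by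
  have ht : Filter.Tendsto f (Filter.cocompact E) Filter.atTop :=
    Filter.tendsto_atTop_mono h (((Filter.tendsto_pow_atTop two_ne_zero).comp
      (tendsto_norm_cocompact_atTop (E := E))).const_mul_atTop hc)
  obtain ⟨x, hx⟩ := hf.exists_forall_le ht
  exact ⟨x, fun y _ => hx y⟩

/-! ### The objective along a line: first and second variation. -/

section Expansion

variable {ι κ : Type*} [Fintype ι] [Fintype κ]

theorem frobenius_norm_sq_eq_sum (M : Matrix ι κ ℝ) : ‖M‖ ^ 2 = ∑ i, ∑ j, M i j ^ 2 := by
  have h0 : 0 ≤ ∑ i, ∑ j, M i j ^ 2 :=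
    Finset.sum_nonneg fun _ _ => Finset.sum_nonneg fun _ _ => sq_nonneg _
  rw [frobenius_norm_def, ← Real.sqrt_eq_rpow]
  simp only [Real.rpow_two, Real.norm_eq_abs, sq_abs]
  exact Real.sq_sqrt h0

theorem frobenius_norm_sq_eq_trace (M : Matrix ι κ ℝ) : ‖M‖ ^ 2 = trace (M * Mᵀ) := by
  rw [frobenius_norm_sq_eq_sum]
  simp [trace, mul_apply, sq]

theorem trace_mul_mul_transpose_symm {C : Matrix κ κ ℝ} (hC : Cᵀ = C) (P Q : Matrix ι κ ℝ) :
    trace (P * C * Qᵀ) = trace (Q * C * Pᵀ) := by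
  rw [← trace_transpose]
  simp [hC, Matrix.mul_assoc]

theorem trace_quadratic_expand {C : Matrix κ κ ℝ} (hC : Cᵀ = C) (P Q R : Matrix ι κ ℝ) (t : ℝ) :
    trace ((P - t • Q - t ^ 2 • R) * C * (P - t • Q - t ^ 2 • R)ᵀ)
      = trace (P * C * Pᵀ) - 2 * trace (P * C * Qᵀ) * t
        + (trace (Q * C * Qᵀ) - 2 * trace (P * C * Rᵀ)) * t ^ 2
        + 2 * trace (Q * C * Rᵀ) * t ^ 3 + trace (R * C * Rᵀ) * t ^ 4 := by
  simp only [transpose_sub, transpose_smul, Matrix.sub_mul, Matrix.mul_sub, Matrix.smul_mul,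
    Matrix.mul_smul, trace_sub, trace_smul, smul_eq_mul]
  rw [trace_mul_mul_transpose_symm hC Q P, trace_mul_mul_transpose_symm hC R P,
    trace_mul_mul_transpose_symm hC R Q]
  ring

variable {m n k : ℕ}

theorem empCov_transpose (X : Matrix (Fin m) (Fin n) ℝ) : (empCov X)ᵀ = empCov X := by
  simp [empCov, transpose_smul]

theorem trace_mul_empCov_mul (X : Matrix (Fin m) (Fin n) ℝ) (P Q : Matrix ι (Fin m) ℝ) :
    trace (P * empCov X * Qᵀ) = 1 / (n : ℝ) * trace ((P * X) * (Q * X)ᵀ) := by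
  simp [empCov, Matrix.mul_assoc]

theorem dotProduct_empCov_mulVec_nonneg (X : Matrix (Fin m) (Fin n) ℝ) (v : Fin m → ℝ) :
    0 ≤ v ⬝ᵥ empCov X *ᵥ v := by
  have : v ⬝ᵥ empCov X *ᵥ v = 1 / (n : ℝ) * ((Xᵀ *ᵥ v) ⬝ᵥ (Xᵀ *ᵥ v)) := by
    rw [empCov, smul_mulVec, dotProduct_smul, smul_eq_mul, ← mulVec_mulVec, dotProduct_mulVec,
      ← mulVec_transpose]
  rw [this]
  exact mul_nonneg (by positivity) (Finset.sum_nonneg fun _ _ => mul_self_nonneg _)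

theorem objective_eq_trace (X : Matrix (Fin m) (Fin n) ℝ) {lam : Fin k → ℝ}
    (hlam : ∀ i, 0 < lam i) (W : Weights m k) :
    objective X lam W = trace ((1 - W.2 * W.1) * empCov X * (1 - W.2 * W.1)ᵀ)
      + trace (W.1ᵀ * diagonal lam * W.1ᵀᵀ) + trace (W.2 * diagonal lam * W.2ᵀ) := by
  have hs : diagonal (fun i => Real.sqrt (lam i)) * diagonal (fun i => Real.sqrt (lam i))
      = diagonal lam := by
    rw [diagonal_mul_diagonal]
    exact congrArg _ (funext fun i => Real.mul_self_sqrt (hlam i).le)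
  rw [objective, trace_mul_empCov_mul, Matrix.sub_mul, Matrix.one_mul, frobenius_norm_sq_eq_trace,
    ← frobenius_norm_transpose (diagonal _ * W.1), frobenius_norm_sq_eq_trace,
    frobenius_norm_sq_eq_trace]
  simp only [transpose_mul, diagonal_transpose, transpose_transpose, Matrix.mul_assoc, ← hs]

/-- Half the derivative of the objective at `(A, B)` in the direction `(Y, Z)`. -/
def slope (C : Matrix (Fin m) (Fin m) ℝ) (lam : Fin k → ℝ) (W V : Weights m k) : ℝ :=
  trace (W.1ᵀ * diagonal lam * V.1ᵀᵀ) + trace (W.2 * diagonal lam * V.2ᵀ)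
    - trace ((1 - W.2 * W.1) * C * (V.2 * W.1 + W.2 * V.1)ᵀ)

/-- Half the Hessian form of the objective at `(A, B)` in the direction `(Y, Z)`. -/
def curvature (C : Matrix (Fin m) (Fin m) ℝ) (lam : Fin k → ℝ) (W V : Weights m k) : ℝ :=
  trace ((V.2 * W.1 + W.2 * V.1) * C * (V.2 * W.1 + W.2 * V.1)ᵀ)
    - 2 * trace ((1 - W.2 * W.1) * C * (V.2 * V.1)ᵀ)
    + trace (V.1ᵀ * diagonal lam * V.1ᵀᵀ) + trace (V.2 * diagonal lam * V.2ᵀ)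

/-- The residual `1 - W₂ W₁` is quadratic in `t`, so its square is quartic; the penalties contribute
only up to degree two. -/
theorem objective_line (X : Matrix (Fin m) (Fin n) ℝ) {lam : Fin k → ℝ}
    (hlam : ∀ i, 0 < lam i) (W V : Weights m k) (t : ℝ) :
    objective X lam (W + t • V) = objective X lam W + 2 * slope (empCov X) lam W V * t
      + curvature (empCov X) lam W V * t ^ 2
      + 2 * trace ((V.2 * W.1 + W.2 * V.1) * empCov X * (V.2 * V.1)ᵀ) * t ^ 3
      + trace ((V.2 * V.1) * empCov X * (V.2 * V.1)ᵀ) * t ^ 4 := by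
  have e : (1 : Matrix (Fin m) (Fin m) ℝ) - (W + t • V).2 * (W + t • V).1
      = (1 - W.2 * W.1) - t • (V.2 * W.1 + W.2 * V.1) - t ^ 2 • (V.2 * V.1) := by
    simp only [Prod.fst_add, Prod.snd_add, Prod.smul_fst, Prod.smul_snd, Matrix.add_mul,
      Matrix.mul_add, Matrix.smul_mul, Matrix.mul_smul, smul_smul, smul_add, sq]
    abel
  have q (P Q : Matrix (Fin m) (Fin k) ℝ) :
      trace ((P + t • Q) * diagonal lam * (P + t • Q)ᵀ) = trace (P * diagonal lam * Pᵀ)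
        + 2 * trace (P * diagonal lam * Qᵀ) * t + trace (Q * diagonal lam * Qᵀ) * t ^ 2 := by
    -- The choice `R = 0` and the sign `-t` turn `P - t • Q - t ^ 2 • R` into `P + t • Q`.
    have := trace_quadratic_expand (diagonal_transpose lam) P Q 0 (-t)
    simp only [smul_zero, sub_zero, neg_smul, sub_neg_eq_add] at this
    rw [this]
    simp
  rw [objective_eq_trace X hlam, objective_eq_trace X hlam, e,
    trace_quadratic_expand (empCov_transpose X)]
  simp only [Prod.fst_add, Prod.snd_add, Prod.smul_fst, Prod.smul_snd]
  rw [transpose_add W.1, transpose_smul, q, q, slope, curvature]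
  ring

theorem contDiff_sum_sq {E : Type*} [NormedAddCommGroup E] [NormedSpace ℝ E] {g : ι → κ → E → ℝ}
    (h : ∀ i j, ContDiff ℝ 2 (g i j)) : ContDiff ℝ 2 fun x => ∑ i, ∑ j, g i j x ^ 2 :=
  ContDiff.sum fun i _ => ContDiff.sum fun j _ => (h i j).pow 2

theorem contDiff_objective (X : Matrix (Fin m) (Fin n) ℝ) (lam : Fin k → ℝ) :
    ContDiff ℝ 2 (objective X lam) := by
  have h1 (i : Fin k) (j : Fin m) : ContDiff ℝ 2 fun W : Weights m k => W.1 i j :=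
    contDiff_linearMap ((Matrix.entryLinearMap ℝ ℝ i j).comp
      (LinearMap.fst ℝ (Matrix (Fin k) (Fin m) ℝ) (Matrix (Fin m) (Fin k) ℝ)))
  have h2 (i : Fin m) (j : Fin k) : ContDiff ℝ 2 fun W : Weights m k => W.2 i j :=
    contDiff_linearMap ((Matrix.entryLinearMap ℝ ℝ i j).comp
      (LinearMap.snd ℝ (Matrix (Fin k) (Fin m) ℝ) (Matrix (Fin m) (Fin k) ℝ)))
  unfold objective
  simp only [frobenius_norm_sq_eq_sum, Matrix.sub_apply, mul_apply]
  refine ((contDiff_const.mul (contDiff_sum_sq fun i j => ?_)).add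
    (contDiff_sum_sq fun i j => ?_)).add (contDiff_sum_sq fun i j => ?_)
  · exact contDiff_const.sub (ContDiff.sum fun _ _ =>
      (ContDiff.sum fun _ _ => (h2 _ _).mul (h1 _ _)).mul contDiff_const)
  · exact ContDiff.sum fun _ _ => contDiff_const.mul (h1 _ _)
  · exact ContDiff.sum fun _ _ => (h2 _ _).mul contDiff_const

theorem isStationary_iff (X : Matrix (Fin m) (Fin n) ℝ) {lam : Fin k → ℝ}
    (hlam : ∀ i, 0 < lam i) (W : Weights m k) :
    IsStationary (objective X lam) W ↔ ∀ V, slope (empCov X) lam W V = 0 := by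
  refine (isStationary_iff_of_quartic (contDiff_objective X lam)
    (objective_line X hlam W)).trans ?_
  simp

theorem hessian_objective (X : Matrix (Fin m) (Fin n) ℝ) {lam : Fin k → ℝ}
    (hlam : ∀ i, 0 < lam i) (W V : Weights m k) :
    fderiv ℝ (fderiv ℝ (objective X lam)) W V V = 2 * curvature (empCov X) lam W V :=
  fderiv_fderiv_of_quartic (contDiff_objective X lam) (objective_line X hlam W V)

theorem curvature_nonneg_of_isLocalMin (X : Matrix (Fin m) (Fin n) ℝ) {lam : Fin k → ℝ}
    (hlam : ∀ i, 0 < lam i) {W : Weights m k} (hst : IsStationary (objective X lam) W)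
    (h : IsLocalMin (objective X lam) W) (V : Weights m k) :
    0 ≤ curvature (empCov X) lam W V :=
  coeff_two_nonneg_of_isLocalMin h (objective_line X hlam W V)
    (by rw [(isStationary_iff X hlam W).1 hst V, mul_zero])

/-- With the decoder fixed, the objective is a strictly convex quadratic in the encoder, so
perturbing a single encoder entry already increases it. -/
theorem not_isLocalMax_of_isStationary (hk : 0 < k) (hm : 0 < m) (X : Matrix (Fin m) (Fin n) ℝ)
    {lam : Fin k → ℝ} (hlam : ∀ i, 0 < lam i) {W : Weights m k}
    (hst : IsStationary (objective X lam) W) : ¬ IsLocalMax (objective X lam) W := by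
  let V : Weights m k := (Matrix.single ⟨0, hk⟩ ⟨0, hm⟩ 1, 0)
  refine not_isLocalMax_of_quadratic (v := V) (a₂ := curvature (empCov X) lam W V) ?_ fun t => ?_
  · have h1 : 0 ≤ trace ((W.2 * V.1) * empCov X * (W.2 * V.1)ᵀ) := by
      rw [trace_mul_empCov_mul, ← frobenius_norm_sq_eq_trace]
      positivity
    have h2 : trace (V.1ᵀ * diagonal lam * V.1ᵀᵀ) = lam ⟨0, hk⟩ := by
      simp [V]
    have h3 := hlam ⟨0, hk⟩
    simp only [curvature, h2]
    simp only [show V.2 = 0 from rfl, Matrix.zero_mul, zero_add, transpose_zero, Matrix.mul_zero,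
      trace_zero]
    linarith
  · refine (objective_line X hlam W V t).trans ?_
    rw [(isStationary_iff X hlam W).1 hst V]
    simp [show V.2 = 0 from rfl]

end Expansion

/-! ### First-order equations and simultaneous diagonality. -/

section Stationary

variable {m k : ℕ} {C : Matrix (Fin m) (Fin m) ℝ} {lam : Fin k → ℝ}
  {A : Matrix (Fin k) (Fin m) ℝ} {B : Matrix (Fin m) (Fin k) ℝ}

/-- Stationarity in the encoder directions `(Y, 0)`, using nondegeneracy of the trace pairing. -/
theorem encoder_eq_of_slope_eq_zero (hC : Cᵀ = C) (h : ∀ V, slope C lam (A, B) V = 0) :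
    Bᵀ * C = diagonal lam * A + Bᵀ * B * A * C := by
  have e : Aᵀ * diagonal lam = C * (1 - B * A)ᵀ * B := by
    refine ext_iff_trace_mul_right.2 fun Y => ?_
    have := h (Y, 0)
    simp only [slope, transpose_zero, Matrix.mul_zero, trace_zero, add_zero, Matrix.zero_mul,
      zero_add, transpose_transpose] at this
    rw [sub_eq_zero.1 this, ← trace_transpose]
    simp only [transpose_mul, transpose_transpose, hC]
    rw [trace_mul_comm]
    simp only [Matrix.mul_assoc]
  have e' := congrArg transpose e
  simp only [transpose_mul, transpose_transpose, diagonal_transpose, hC] at e'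
  rw [e']
  simp only [Matrix.sub_mul, Matrix.mul_sub, Matrix.one_mul, Matrix.mul_assoc]
  abel

theorem decoder_eq_of_slope_eq_zero (h : ∀ V, slope C lam (A, B) V = 0) :
    C * Aᵀ = B * (A * C * Aᵀ + diagonal lam) := by
  have e : B * diagonal lam = (1 - B * A) * C * Aᵀ := by
    refine ext_iff_trace_mul_right.2 fun Y => ?_
    have := h (0, Yᵀ)
    simp only [slope, transpose_zero, Matrix.mul_zero, trace_zero, add_zero,
      zero_add, transpose_transpose] at this
    rw [sub_eq_zero.1 this]
    simp only [transpose_mul, transpose_transpose, Matrix.mul_assoc]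
  rw [Matrix.mul_add, e]
  simp only [Matrix.sub_mul, Matrix.one_mul, Matrix.mul_assoc]
  abel

/-- Two symmetric matrices intertwined by a positive diagonal matrix with distinct entries are
diagonal and equal. -/
theorem diagonal_of_intertwined (hpos : ∀ i, 0 < lam i) (hinj : Function.Injective lam)
    {P Q : Matrix (Fin k) (Fin k) ℝ} (hP : Pᵀ = P) (hQ : Qᵀ = Q)
    (h : Q * diagonal lam = diagonal lam * P) :
    (∀ i j, i ≠ j → P i j = 0) ∧ Q = P := by
  have e (i j : Fin k) : Q i j * lam j = lam i * P i j := by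
    simpa using congrFun (congrFun h i) j
  have off (i j : Fin k) (hij : i ≠ j) : P i j = 0 := by
    have e1 := e i j
    have e2 := e j i
    rw [← hP, ← hQ, transpose_apply, transpose_apply] at e2
    have h3 : P i j * ((lam i - lam j) * (lam i + lam j)) = 0 := by
      linear_combination lam j * e2 - lam i * e1
    have h4 : lam i - lam j ≠ 0 := sub_ne_zero.2 fun h => hij (hinj h)
    have h5 : lam i + lam j ≠ 0 := (add_pos (hpos i) (hpos j)).ne'
    exact (mul_eq_zero.1 h3).resolve_right (mul_ne_zero h4 h5)
  refine ⟨off, Matrix.ext fun i j => ?_⟩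
  by_cases hij : i = j
  · subst hij
    exact mul_right_cancel₀ (hpos i).ne' ((e i i).trans (mul_comm _ _))
  · have := e i j
    rw [off i j hij, mul_zero] at this
    rw [off i j hij]
    exact (mul_eq_zero.1 this).resolve_right (hpos j).ne'

/-- A matrix commuting with the square of a positive diagonal matrix with distinct entries is
diagonal. -/
theorem diagonal_of_commute_sq (hpos : ∀ i, 0 < lam i) (hinj : Function.Injective lam)
    {N : Matrix (Fin k) (Fin k) ℝ}
    (h : diagonal lam * diagonal lam * N = N * (diagonal lam * diagonal lam)) (i j : Fin k)
    (hij : i ≠ j) : N i j = 0 := by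
  have e : lam i * lam i * N i j = N i j * (lam j * lam j) := by
    simpa [diagonal_mul_diagonal] using congrFun (congrFun h i) j
  have h3 : N i j * ((lam i - lam j) * (lam i + lam j)) = 0 := by linear_combination e
  have h4 : lam i - lam j ≠ 0 := sub_ne_zero.2 fun h => hij (hinj h)
  have h5 : lam i + lam j ≠ 0 := (add_pos (hpos i) (hpos j)).ne'
  exact (mul_eq_zero.1 h3).resolve_right (mul_ne_zero h4 h5)

theorem mul_mul_apply_eq_dotProduct (A : Matrix (Fin k) (Fin m) ℝ) (C : Matrix (Fin m) (Fin m) ℝ)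
    (B : Matrix (Fin m) (Fin k) ℝ) (i j : Fin k) :
    (A * C * B) i j = A i ⬝ᵥ C *ᵥ Bᵀ j := by
  rw [Matrix.mul_assoc]
  rfl

/-- Stationary pairs are diagonal: `A Aᵀ` and `A C Aᵀ` are diagonal, and `Bᵀ B = A Aᵀ`. -/
theorem gram_diagonal_of_slope_eq_zero (hC : Cᵀ = C) (hpos : ∀ i, 0 < lam i)
    (hinj : Function.Injective lam) (h : ∀ V, slope C lam (A, B) V = 0) :
    Bᵀ * B = A * Aᵀ ∧ (∀ i j, i ≠ j → (A * Aᵀ) i j = 0) ∧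
      ∀ i j, i ≠ j → (A * C * Aᵀ + diagonal lam) i j = 0 := by
  have h1 := encoder_eq_of_slope_eq_zero hC h
  have h2 := decoder_eq_of_slope_eq_zero h
  set N := A * C * Aᵀ + diagonal lam with hN
  have hNt : Nᵀ = N := by simp [hN, hC, Matrix.mul_assoc]
  have hG : A * C * Aᵀ = N - diagonal lam := by simp [hN]
  -- Compute `Bᵀ C Aᵀ` from each of the two equations; the term `Bᵀ B A C Aᵀ` cancels.
  have hPQ : Bᵀ * B * diagonal lam = diagonal lam * (A * Aᵀ) := by
    have e1 : Bᵀ * (C * Aᵀ) = Bᵀ * B * (A * C * Aᵀ) + Bᵀ * B * diagonal lam := by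
      rw [h2, hN, ← Matrix.mul_assoc, Matrix.mul_add]
    have e2 : Bᵀ * (C * Aᵀ) = diagonal lam * (A * Aᵀ) + Bᵀ * B * (A * C * Aᵀ) := by
      rw [← Matrix.mul_assoc, h1, Matrix.add_mul]
      simp only [Matrix.mul_assoc]
    rw [e2, add_comm] at e1
    exact (add_left_cancel e1).symm
  obtain ⟨hoff, hD⟩ := diagonal_of_intertwined hpos hinj (P := A * Aᵀ) (Q := Bᵀ * B)
    (by simp) (by simp) hPQ
  refine ⟨hD, hoff, diagonal_of_commute_sq hpos hinj ?_⟩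
  have hACB : A * C * B = N * (Bᵀ * B) := by
    have := congrArg (fun M => Bᵀ * M) h2
    have := congrArg transpose this
    simpa [hC, hNt, Matrix.mul_assoc] using this
  -- Write `Λ` for `diagonal lam`. This `R` is symmetric by the encoder equation and satisfies `R N
  -- = Λ (N - Λ)` by the decoder equation. So `(Λ - R) N = Λ²`, and transposing gives `N (Λ - R) =
  -- Λ²`; hence `N` commutes with `Λ²`.
  let R := diagonal lam * (A * B)
  have hR : R = Bᵀ * C * B - Bᵀ * B * N * (Bᵀ * B) := by
    have : Bᵀ * C * B = R + Bᵀ * B * (A * C * B) := by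
      rw [h1, Matrix.add_mul]
      simp only [R, Matrix.mul_assoc]
    rw [this, hACB]
    simp only [Matrix.mul_assoc]
    abel
  have hRt : Rᵀ = R := by
    rw [hR]
    simp [hC, hNt, Matrix.mul_assoc]
  have hRN : R * N = diagonal lam * (N - diagonal lam) := by
    rw [← hG, Matrix.mul_assoc A, h2]
    simp only [R, Matrix.mul_assoc]
  have hH : (diagonal lam - R) * N = diagonal lam * diagonal lam := by
    rw [Matrix.sub_mul, hRN, Matrix.mul_sub]
    abel
  have hH' : N * (diagonal lam - R) = diagonal lam * diagonal lam := by
    have := congrArg transpose hH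
    simpa [hNt, hRt] using this
  rw [← hH]
  nth_rewrite 1 [hH]
  rw [← hH', Matrix.mul_assoc]

end Stationary

/-! ### Stationary points are eigenvector encoders with transposed decoders. -/

section Structure

variable {m k : ℕ} {C : Matrix (Fin m) (Fin m) ℝ} {lam : Fin k → ℝ}
  {A : Matrix (Fin k) (Fin m) ℝ} {B : Matrix (Fin m) (Fin k) ℝ}

theorem dotProduct_mulVec_symm (hC : Cᵀ = C) (x y : Fin m → ℝ) :
    x ⬝ᵥ C *ᵥ y = y ⬝ᵥ C *ᵥ x := by
  rw [dotProduct_mulVec, ← mulVec_transpose, hC, dotProduct_comm]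

theorem dotProduct_self_nonneg_real (x : Fin m → ℝ) : 0 ≤ x ⬝ᵥ x :=
  Finset.sum_nonneg fun _ _ => mul_self_nonneg _

theorem dotProduct_self_pos_real {x : Fin m → ℝ} (hx : x ≠ 0) : 0 < x ⬝ᵥ x :=
  (dotProduct_self_nonneg_real x).lt_of_ne' fun h => hx (dotProduct_self_eq_zero.1 h)

/-- Put `g = b - d a`, so that `C g = l a`. Semidefiniteness at `g` gives `a · b ≥ d²`, whence `|g|²
≤ d - d³`. If `d ≥ 1` this forces `g = 0`, then `a = 0`, contradicting `|a|² = d`. -/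
theorem norm_lt_one_of_coupled (hpsd : ∀ v, 0 ≤ v ⬝ᵥ C *ᵥ v) {a b : Fin m → ℝ} {l d ν : ℝ}
    (hl : 0 < l) (ha : C *ᵥ a = ν • b) (hb : C *ᵥ b = l • a + (d * ν) • b)
    (haa : a ⬝ᵥ a = d) (hbb : b ⬝ᵥ b = d) : d < 1 := by
  by_contra! hd
  have hg : C *ᵥ (b - d • a) = l • a := by
    rw [mulVec_sub, mulVec_smul, ha, hb, smul_smul, add_sub_cancel_right]
  have h1 := hpsd (b - d • a)
  rw [hg, dotProduct_smul, smul_eq_mul, sub_dotProduct, smul_dotProduct, haa, smul_eq_mul] at h1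
  have h2 : 0 ≤ b ⬝ᵥ a - d * d := nonneg_of_mul_nonneg_right h1 hl
  have h3 : (b - d • a) ⬝ᵥ (b - d • a) = d - 2 * d * (b ⬝ᵥ a) + d ^ 3 := by
    simp only [sub_dotProduct, dotProduct_sub, smul_dotProduct, dotProduct_smul, smul_eq_mul,
      haa, hbb, dotProduct_comm a b]
    ring
  have h4 := dotProduct_self_nonneg_real (b - d • a)
  have h5 : (b - d • a) ⬝ᵥ (b - d • a) = 0 := by
    rw [h3] at h4 ⊢
    nlinarith [mul_nonneg (by linarith : 0 ≤ d) h2,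
      mul_nonneg (mul_nonneg (by linarith : 0 ≤ d) (by linarith : 0 ≤ d + 1))
        (by linarith : 0 ≤ d - 1)]
  rw [dotProduct_self_eq_zero.1 h5, mulVec_zero] at hg
  have h6 : a = 0 := (smul_eq_zero.1 hg.symm).resolve_left hl.ne'
  rw [h6, zero_dotProduct] at haa
  linarith

/-- Semidefiniteness at `a - b` gives `(a · b - d) ((1 - d) ν + l) ≥ 0`. The second factor is
positive because `d < 1`, so `a · b ≥ d`, while `|a - b|² = 2 (d - a · b)`. -/
theorem eq_of_coupled (hpsd : ∀ v, 0 ≤ v ⬝ᵥ C *ᵥ v) {a b : Fin m → ℝ} {l d ν : ℝ}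
    (hl : 0 < l) (hν : l ≤ ν) (ha : C *ᵥ a = ν • b) (hb : C *ᵥ b = l • a + (d * ν) • b)
    (haa : a ⬝ᵥ a = d) (hbb : b ⬝ᵥ b = d) : a = b := by
  have hd := norm_lt_one_of_coupled hpsd hl ha hb haa hbb
  have h1 := hpsd (a - b)
  have e1 : (a - b) ⬝ᵥ C *ᵥ (a - b) = (a ⬝ᵥ b - d) * ((1 - d) * ν + l) := by
    rw [mulVec_sub, ha, hb]
    simp only [sub_dotProduct, dotProduct_sub, dotProduct_smul, dotProduct_add,
      smul_eq_mul, haa, hbb, dotProduct_comm b a]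
    ring
  have e2 : (a - b) ⬝ᵥ (a - b) = 2 * (d - a ⬝ᵥ b) := by
    simp only [sub_dotProduct, dotProduct_sub, haa, hbb, dotProduct_comm b a]
    ring
  have h2 : 0 < (1 - d) * ν + l := by nlinarith
  rw [e1] at h1
  have h3 := nonneg_of_mul_nonneg_left h1 h2
  have h4 := dotProduct_self_nonneg_real (a - b)
  exact sub_eq_zero.1 (dotProduct_self_eq_zero.1 (by linarith))

/-- The rows of `A` are orthogonal eigenvectors of `C` with eigenvalues `ν i`, and
`‖A i‖ ^ 2 = 1 - lam i / ν i`. -/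
structure IsEigenEncoder (C : Matrix (Fin m) (Fin m) ℝ) (lam ν : Fin k → ℝ)
    (A : Matrix (Fin k) (Fin m) ℝ) : Prop where
  le : ∀ i, lam i ≤ ν i
  eigen : ∀ i, C *ᵥ A i = ν i • A i
  norm : ∀ i, ν i * (A i ⬝ᵥ A i) = ν i - lam i
  orthogonal : ∀ i j, i ≠ j → A i ⬝ᵥ A j = 0

/-- Once the Gram matrices are diagonal, row `i` of `A` and column `i` of `B` satisfy the coupled
system of `eq_of_coupled` and therefore agree; `ν i` is the `i`-th diagonal entry of `A C Aᵀ +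
diagonal lam`. -/
theorem exists_isEigenEncoder_of_slope_eq_zero (hC : Cᵀ = C) (hpsd : ∀ v, 0 ≤ v ⬝ᵥ C *ᵥ v)
    (hpos : ∀ i, 0 < lam i) (hinj : Function.Injective lam)
    (h : ∀ V, slope C lam (A, B) V = 0) : B = Aᵀ ∧ ∃ ν, IsEigenEncoder C lam ν A := by
  obtain ⟨hBB, hoff, hNoff⟩ := gram_diagonal_of_slope_eq_zero hC hpos hinj h
  have h1 := encoder_eq_of_slope_eq_zero hC h
  have h2 := decoder_eq_of_slope_eq_zero h
  set N := A * C * Aᵀ + diagonal lam with hN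
  let ν i := N i i
  let d i := A i ⬝ᵥ A i
  have hNd : N = diagonal ν := by
    ext i j
    by_cases hij : i = j
    · subst hij; simp [ν]
    · rw [hNoff i j hij, diagonal_apply_ne _ hij]
  have hDd : A * Aᵀ = diagonal d := by
    ext i j
    by_cases hij : i = j
    · subst hij; simp [d, mul_apply, dotProduct]
    · rw [hoff i j hij, diagonal_apply_ne _ hij]
  have hν (i) : ν i = A i ⬝ᵥ C *ᵥ A i + lam i := by
    simp only [ν, hN, Matrix.add_apply, diagonal_apply_eq, mul_mul_apply_eq_dotProduct,
      transpose_transpose]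
  have hle (i) : lam i ≤ ν i := by
    rw [hν]
    linarith [hpsd (A i)]
  have ha (i) : C *ᵥ A i = ν i • Bᵀ i := by
    ext x
    have := congrFun (congrFun (h2.trans (congrArg (B * ·) hNd)) x) i
    rw [mul_diagonal] at this
    rw [Pi.smul_apply, smul_eq_mul, mul_comm]
    exact this
  have hb (i) : C *ᵥ Bᵀ i = lam i • A i + (d i * ν i) • Bᵀ i := by
    have : (Bᵀ * C) i = (diagonal lam * A + diagonal d * (A * C)) i := by
      rw [h1, hBB, hDd, Matrix.mul_assoc]
    rw [mul_smul, ← ha]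
    ext x
    have := congrFun this x
    rw [Matrix.add_apply, diagonal_mul, diagonal_mul, mul_apply_eq_vecMul, mul_apply_eq_vecMul,
      ← mulVec_transpose, ← mulVec_transpose, hC] at this
    simpa using this
  have hbb (i) : Bᵀ i ⬝ᵥ Bᵀ i = d i := by
    have := congrFun (congrFun (hBB.trans hDd) i) i
    rwa [diagonal_apply_eq] at this
  have hab (i) : ν i * (A i ⬝ᵥ Bᵀ i) = ν i - lam i := by
    rw [← smul_eq_mul, ← dotProduct_smul, ← ha, hν]
    ring
  have hAB (i) : A i = Bᵀ i := eq_of_coupled hpsd (hpos i) (hle i) (ha i) (hb i) rfl (hbb i)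
  have hBA : B = Aᵀ := by
    ext x i
    exact (congrFun (hAB i) x).symm
  subst hBA
  refine ⟨rfl, ν, hle, ha, hab, fun i j hij => ?_⟩
  exact hoff i j hij

/-! ### Second-order conditions along symmetric directions `(Y, Yᵀ)`. -/

theorem curvature_symm_pair (A Y : Matrix (Fin k) (Fin m) ℝ) :
    curvature C lam (A, Aᵀ) (Y, Yᵀ) = trace ((Yᵀ * A + Aᵀ * Y) * (C * (Yᵀ * A + Aᵀ * Y)))
      - 2 * trace ((1 - Aᵀ * A) * (C * (Yᵀ * Y))) + 2 * trace (Yᵀ * (diagonal lam * Y)) := by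
  have e : (Yᵀ * A + Aᵀ * Y)ᵀ = Yᵀ * A + Aᵀ * Y := by simp [add_comm]
  simp only [curvature, e, transpose_mul, transpose_transpose, Matrix.mul_assoc]
  ring

theorem transpose_mulVec_single_one_row (A : Matrix (Fin k) (Fin m) ℝ) (i : Fin k) :
    Aᵀ *ᵥ Pi.single i 1 = A i := by
  ext x
  simp

theorem single_one_vecMul_row (A : Matrix (Fin k) (Fin m) ℝ) (i : Fin k) :
    Pi.single i 1 ᵥ* A = A i := by
  ext x
  simp

theorem diagonal_mulVec_single_one (lam : Fin k → ℝ) (i : Fin k) :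
    diagonal lam *ᵥ Pi.single i 1 = lam i • Pi.single i 1 := by
  ext x
  by_cases hx : x = i
  · subst hx; simp [mulVec_diagonal]
  · simp [mulVec_diagonal, hx]

/-- Moving row `i` towards `u` has curvature `(ν i + lam i) (ν i - s) / ν i`, which is negative when
the unused eigenvalue `s` exceeds `ν i`. -/
theorem IsEigenEncoder.le_of_curvature_nonneg {ν : Fin k → ℝ} (hA : IsEigenEncoder C lam ν A)
    (hpos : ∀ i, 0 < lam i) (h : ∀ V, 0 ≤ curvature C lam (A, Aᵀ) V) {u : Fin m → ℝ} {s : ℝ}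
    (hCu : C *ᵥ u = s • u) (hu : u ⬝ᵥ u = 1) (hAu : A *ᵥ u = 0) (i : Fin k) : s ≤ ν i := by
  have hau : A i ⬝ᵥ u = 0 := congrFun hAu i
  have hc := h (vecMulVec (Pi.single i 1) u, (vecMulVec (Pi.single i 1) u)ᵀ)
  have e3 : (1 - Aᵀ * A) *ᵥ u = u := by
    rw [sub_mulVec, one_mulVec, ← mulVec_mulVec, hAu, mulVec_zero, sub_zero]
  rw [curvature_symm_pair] at hc
  simp only [transpose_vecMulVec, vecMulVec_mul, single_one_vecMul_row, mul_vecMulVec,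
    transpose_mulVec_single_one_row, Matrix.mul_add, add_mulVec, vecMulVec_mulVec, hCu, hA.eigen,
    mulVec_smul, e3, diagonal_mulVec_single_one, op_smul_eq_smul, trace_add, trace_vecMulVec,
    smul_dotProduct, add_dotProduct, smul_eq_mul, hu, hau,
    dotProduct_comm u (A i), dotProduct_single, Pi.single_eq_same] at hc
  have hn := hA.norm i
  have hν : 0 < ν i := (hpos i).trans_le (hA.le i)
  have h1 : 0 ≤ ν i * (A i ⬝ᵥ A i) + s * (A i ⬝ᵥ A i) - 2 * s + 2 * lam i := by
    linear_combination hc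
  have h2 : ν i * (ν i * (A i ⬝ᵥ A i) + s * (A i ⬝ᵥ A i) - 2 * s + 2 * lam i)
      = (ν i + lam i) * (ν i - s) := by
    linear_combination (ν i + s) * hn
  have h3 := mul_nonneg hν.le h1
  rw [h2] at h3
  exact sub_nonneg.1 (nonneg_of_mul_nonneg_right h3 (add_pos hν (hpos i)))

/-- Adding a multiple of row `j` to row `i` and of row `i` to row `j` gives a quadratic form in two
coefficients `α`, `β`, which takes a negative value when the eigenvalues are in the wrong order. An
exact rotation, `β = -α`, would only compare the lengths of the rows. -/
theorem IsEigenEncoder.antitone_of_curvature_nonneg {ν : Fin k → ℝ}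
    (hA : IsEigenEncoder C lam ν A) (hpos : ∀ i, 0 < lam i)
    (h : ∀ V, 0 ≤ curvature C lam (A, Aᵀ) V) {i j : Fin k} (hij : lam i < lam j)
    (hj : A j ≠ 0) : ν j ≤ ν i := by
  have hne : i ≠ j := fun e => hij.ne (congrArg lam e)
  have hd := dotProduct_self_pos_real hj
  have hi0 := dotProduct_self_nonneg_real (A i)
  have hνi : 0 < ν i := (hpos i).trans_le (hA.le i)
  have hνj : 0 < ν j := (hpos j).trans_le (hA.le j)
  have ni := hA.norm i
  have nj := hA.norm j
  have key (α β : ℝ) : 0 ≤ (α + β) ^ 2 * (ν i + ν j) * (A i ⬝ᵥ A i) * (A j ⬝ᵥ A j)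
      + 2 * (lam j - lam i) * (β ^ 2 * (A i ⬝ᵥ A i) - α ^ 2 * (A j ⬝ᵥ A j)) := by
    let Y := α • vecMulVec (Pi.single i 1) (A j) + β • vecMulVec (Pi.single j 1) (A i)
    have hc := h (Y, Yᵀ)
    have e3 (i : Fin k) : A *ᵥ A i = (A i ⬝ᵥ A i) • Pi.single i 1 := by
      ext l
      by_cases hl : l = i
      · subst hl; simp [mulVec]
      · simp [mulVec, hl, hA.orthogonal l i hl]
    have e5 (i : Fin k) : (1 - Aᵀ * A) *ᵥ A i = (1 - A i ⬝ᵥ A i) • A i := by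
      rw [sub_mulVec, one_mulVec, ← mulVec_mulVec, e3, mulVec_smul,
        transpose_mulVec_single_one_row, sub_smul, one_smul]
    rw [curvature_symm_pair] at hc
    simp only [Y, transpose_add, transpose_smul, transpose_vecMulVec, Matrix.add_mul,
      Matrix.smul_mul, vecMulVec_mul, single_one_vecMul_row, Matrix.mul_add, Matrix.mul_smul,
      mul_vecMulVec, transpose_mulVec_single_one_row, add_mulVec, smul_mulVec, vecMulVec_mulVec,
      hA.eigen, mulVec_add, mulVec_smul, e5, diagonal_mulVec_single_one, op_smul_eq_smul,
      trace_add, trace_smul, trace_vecMulVec, smul_dotProduct, add_dotProduct, smul_eq_mul,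
      hA.orthogonal i j hne, hA.orthogonal j i hne.symm, dotProduct_single, Pi.single_eq_same,
      Pi.single_eq_of_ne hne, Pi.single_eq_of_ne hne.symm] at hc
    linear_combination hc + 2 * α ^ 2 * (A j ⬝ᵥ A j) * nj + 2 * β ^ 2 * (A i ⬝ᵥ A i) * ni
  by_contra! hν
  set p := A i ⬝ᵥ A i
  set q := A j ⬝ᵥ A j
  have hδ : 0 < lam j - lam i := sub_pos.2 hij
  have hS : 0 < ν i + ν j := add_pos hνi hνj
  -- For fixed `α`, the form is smallest when `β (q S + 2 δ) = -α q S`, with `S = ν i + ν j` and `δ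
  -- = lam j - lam i`; scaling clears the denominator.
  have h1 := key (q * (ν i + ν j) + 2 * (lam j - lam i)) (-(q * (ν i + ν j)))
  have h2 : 0 ≤ (2 * (lam j - lam i) * q * (q * (ν i + ν j) + 2 * (lam j - lam i)))
      * (p * (ν i + ν j) - q * (ν i + ν j) - 2 * (lam j - lam i)) := by
    linear_combination h1
  have h3 : 0 ≤ p * (ν i + ν j) - q * (ν i + ν j) - 2 * (lam j - lam i) :=
    nonneg_of_mul_nonneg_right h2 (by positivity)
  have h4 : ν i * ν j * (p * (ν i + ν j) - q * (ν i + ν j) - 2 * (lam j - lam i))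
      = -((ν j - ν i) * (ν i * lam j + ν j * lam i)) := by
    linear_combination ν j * (ν i + ν j) * ni - ν i * (ν i + ν j) * nj
  have h5 := mul_nonneg (mul_pos hνi hνj).le h3
  have h6 : 0 < (ν j - ν i) * (ν i * lam j + ν j * lam i) :=
    mul_pos (sub_pos.2 hν) (add_pos (mul_pos hνi (hpos j)) (mul_pos hνj (hpos i)))
  linarith

end Structure

/-! ### Matching the rows with the top eigenvectors. -/

section TopEigensystem

variable {m k : ℕ} {C : Matrix (Fin m) (Fin m) ℝ} {U : Matrix (Fin m) (Fin k) ℝ}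
  {σ lam : Fin k → ℝ}

theorem IsTopEigensystem.dotProduct_self (hU : IsTopEigensystem C U σ) (l : Fin k) :
    Uᵀ l ⬝ᵥ Uᵀ l = 1 := by
  have := congrFun (congrFun hU.orthonormal l) l
  rwa [one_apply_eq] at this

theorem IsTopEigensystem.dotProduct_of_ne (hU : IsTopEigensystem C U σ) {l l' : Fin k}
    (h : l ≠ l') : Uᵀ l ⬝ᵥ Uᵀ l' = 0 := by
  have := congrFun (congrFun hU.orthonormal l) l'
  rwa [one_apply_ne h] at this

theorem IsTopEigensystem.mulVec (hU : IsTopEigensystem C U σ) (l : Fin k) :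
    C *ᵥ Uᵀ l = (σ l ^ 2) • Uᵀ l := by
  ext x
  have := congrFun (congrFun hU.eigen x) l
  rw [mul_diagonal, mul_comm] at this
  exact this

theorem eigenvalue_eq_of_dotProduct_ne_zero (hC : Cᵀ = C) {x y : Fin m → ℝ} {s t : ℝ}
    (hx : C *ᵥ x = s • x) (hy : C *ᵥ y = t • y) (h : x ⬝ᵥ y ≠ 0) : s = t := by
  have := dotProduct_mulVec_symm hC x y
  rw [hx, hy, dotProduct_smul, dotProduct_smul, dotProduct_comm y x] at this
  exact (mul_right_cancel₀ h this).symm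

/-- The top eigenspaces are lines. -/
theorem IsTopEigensystem.eq_smul (hC : Cᵀ = C) (hU : IsTopEigensystem C U σ) {l : Fin k}
    {v : Fin m → ℝ} (hv : C *ᵥ v = (σ l ^ 2) • v) : v = (v ⬝ᵥ Uᵀ l) • Uᵀ l := by
  by_contra hne
  have hw : C *ᵥ (v - (v ⬝ᵥ Uᵀ l) • Uᵀ l) = (σ l ^ 2) • (v - (v ⬝ᵥ Uᵀ l) • Uᵀ l) := by
    rw [mulVec_sub, mulVec_smul, hv, hU.mulVec, smul_sub, smul_comm]
  have hUw : Uᵀ *ᵥ (v - (v ⬝ᵥ Uᵀ l) • Uᵀ l) = 0 := by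
    ext l'
    change Uᵀ l' ⬝ᵥ (v - (v ⬝ᵥ Uᵀ l) • Uᵀ l) = 0
    rw [dotProduct_sub, dotProduct_smul, smul_eq_mul]
    by_cases hl : l' = l
    · subst hl
      rw [hU.dotProduct_self, dotProduct_comm]
      ring
    · rw [hU.dotProduct_of_ne hl, mul_zero, sub_zero]
      by_contra h0
      exact hl (hU.strictAnti.injective
        (eigenvalue_eq_of_dotProduct_ne_zero hC (hU.mulVec l') hv h0))
  exact lt_irrefl _ (hU.rest_lt _ _ (sub_ne_zero.2 hne) hUw hw l)

/-- A missed column `l` would force every `ν i ≥ σ l ^ 2`. Every row would then be nonzero and, by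
`rest_lt`, a multiple of some column of `U`. By orthogonality the `k` rows use distinct columns, so
they use all `k` of them, including `l`. -/
theorem IsEigenEncoder.exists_dotProduct_ne_zero {ν : Fin k → ℝ} {A : Matrix (Fin k) (Fin m) ℝ}
    (hA : IsEigenEncoder C lam ν A) (hC : Cᵀ = C) (hU : IsTopEigensystem C U σ)
    (hpos : ∀ i, 0 < lam i) (hlt : ∀ i l, lam i < σ l ^ 2)
    (h : ∀ V, 0 ≤ curvature C lam (A, Aᵀ) V) (l : Fin k) : ∃ i, A i ⬝ᵥ Uᵀ l ≠ 0 := by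
  by_contra! hl
  have hν := hA.le_of_curvature_nonneg hpos h (hU.mulVec l) (hU.dotProduct_self l) (funext hl)
  have hex (i : Fin k) : ∃ l', A i ⬝ᵥ Uᵀ l' ≠ 0 := by
    by_contra! h0
    have hne : A i ≠ 0 := by
      intro h1
      have h2 := hA.norm i
      rw [h1, zero_dotProduct, mul_zero] at h2
      linarith [hlt i l, hν i]
    refine (hν i).not_gt (hU.rest_lt _ (A i) hne ?_ (hA.eigen i) l)
    ext l'
    exact (dotProduct_comm _ _).trans (h0 l')
  choose f hf using hex
  have hfA (i) : A i = (A i ⬝ᵥ Uᵀ (f i)) • Uᵀ (f i) := by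
    refine hU.eq_smul hC ?_
    rw [hA.eigen, eigenvalue_eq_of_dotProduct_ne_zero hC (hA.eigen i) (hU.mulVec (f i)) (hf i)]
  have hinj : Function.Injective f := by
    intro i j hij
    by_contra hne
    have h1 := hA.orthogonal i j hne
    rw [hfA j, ← hij, dotProduct_smul, smul_eq_mul, hij] at h1
    exact mul_ne_zero (hf j) (hij ▸ hf i) h1
  obtain ⟨i, hi⟩ := Finite.injective_iff_surjective.1 hinj l
  exact hf i (hi ▸ hl i)

/-- Let `g l` be a row that meets column `l`. The ordering of the eigenvalues makes `g` strictly
increasing, and a strictly increasing self-map of `Fin k` is the identity. -/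
theorem IsEigenEncoder.eigenvalue_eq {ν : Fin k → ℝ} {A : Matrix (Fin k) (Fin m) ℝ}
    (hA : IsEigenEncoder C lam ν A) (hC : Cᵀ = C) (hU : IsTopEigensystem C U σ)
    (hpos : ∀ i, 0 < lam i) (hmono : StrictMono lam) (hlt : ∀ i l, lam i < σ l ^ 2)
    (h : ∀ V, 0 ≤ curvature C lam (A, Aᵀ) V) (l : Fin k) : ν l = σ l ^ 2 := by
  choose g hg using hA.exists_dotProduct_ne_zero hC hU hpos hlt h
  have hν (l) : ν (g l) = σ l ^ 2 :=
    eigenvalue_eq_of_dotProduct_ne_zero hC (hA.eigen _) (hU.mulVec l) (hg l)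
  have hgm : StrictMono g := by
    intro l l' hl
    have h1 : ν (g l') < ν (g l) := by
      rw [hν, hν]
      exact hU.strictAnti hl
    by_contra! hle
    have hne : g l' ≠ g l := fun e => h1.ne (congrArg ν e)
    refine h1.not_ge (hA.antitone_of_curvature_nonneg hpos h (hmono (hle.lt_of_ne hne)) ?_)
    intro h0
    exact hg l (by rw [h0, zero_dotProduct])
  have hgl : g l = l := le_antisymm hgm.apply_le hgm.le_apply
  rw [← hν l, hgl]

theorem IsEigenEncoder.isOrderedAxisAligned {ν : Fin k → ℝ} {A : Matrix (Fin k) (Fin m) ℝ}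
    (hA : IsEigenEncoder C lam ν A) (hC : Cᵀ = C) (hU : IsTopEigensystem C U σ)
    (hpos : ∀ i, 0 < lam i) (hmono : StrictMono lam) (hlt : ∀ i l, lam i < σ l ^ 2)
    (h : ∀ V, 0 ≤ curvature C lam (A, Aᵀ) V) : IsOrderedAxisAligned lam σ U (A, Aᵀ) := by
  have hν := hA.eigenvalue_eq hC hU hpos hmono hlt h
  have hAU (i) : A i = (A i ⬝ᵥ Uᵀ i) • Uᵀ i := hU.eq_smul hC (by rw [hA.eigen, hν])
  have hsq (i) : (A i ⬝ᵥ Uᵀ i) ^ 2 = 1 - lam i / σ i ^ 2 := by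
    have h1 : A i ⬝ᵥ A i = (A i ⬝ᵥ Uᵀ i) ^ 2 := by
      conv_lhs => rw [hAU i]
      rw [smul_dotProduct, dotProduct_smul, hU.dotProduct_self, smul_eq_mul, smul_eq_mul]
      ring
    have h2 := hA.norm i
    rw [hν, h1] at h2
    have h3 := (hU.pos i).ne'
    exact mul_left_cancel₀ h3 (h2.trans (by rw [mul_sub, mul_one, mul_div_cancel₀ _ h3]))
  have hε (i) : ∃ e : ℝ, (e = 1 ∨ e = -1) ∧
      A i ⬝ᵥ Uᵀ i = e * Real.sqrt (1 - lam i / σ i ^ 2) := by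
    rw [← hsq, Real.sqrt_sq_eq_abs]
    rcases le_total 0 (A i ⬝ᵥ Uᵀ i) with h0 | h0
    · exact ⟨1, Or.inl rfl, by rw [abs_of_nonneg h0, one_mul]⟩
    · exact ⟨-1, Or.inr rfl, by rw [abs_of_nonpos h0]; ring⟩
  choose ε hε1 hε2 using hε
  have hAe : A = diagonal ε * shrink lam σ * Uᵀ := by
    ext i x
    rw [hAU i, hε2, shrink, diagonal_mul_diagonal, diagonal_mul]
    rfl
  refine ⟨ε, hε1, hAe, ?_⟩
  change Aᵀ = _
  rw [hAe]
  simp [shrink, Matrix.mul_assoc, mul_comm]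

end TopEigensystem

/-! ### Existence of a minimum and equality of the candidate values. -/

section Minimum

variable {m n k : ℕ} (X : Matrix (Fin m) (Fin n) ℝ) (U : Matrix (Fin m) (Fin k) ℝ)
  {σ lam : Fin k → ℝ}

/-- The signs cancel in `W₂ W₁` and do not affect the penalties. -/
theorem objective_eq_of_isOrderedAxisAligned {W : Weights m k}
    (hW : IsOrderedAxisAligned lam σ U W) :
    objective X lam W = objective X lam (shrink lam σ * Uᵀ, U * shrink lam σ) := by
  obtain ⟨ε, hε, h1, h2⟩ := hW
  have hsq (i) : ε i * ε i = 1 := by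
    rcases hε i with h | h <;> rw [h] <;> norm_num
  have e1 : W.2 * W.1 = U * shrink lam σ * (shrink lam σ * Uᵀ) := by
    have : diagonal ε * diagonal ε = 1 := by
      rw [diagonal_mul_diagonal, funext hsq, diagonal_one]
    rw [h1, h2, Matrix.mul_assoc (diagonal ε), Matrix.mul_assoc (U * _),
      ← Matrix.mul_assoc (diagonal ε), this, Matrix.one_mul]
  have e2 : ‖diagonal (fun i => Real.sqrt (lam i)) * W.1‖ ^ 2
      = ‖diagonal (fun i => Real.sqrt (lam i)) * (shrink lam σ * Uᵀ)‖ ^ 2 := by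
    rw [frobenius_norm_sq_eq_sum, frobenius_norm_sq_eq_sum]
    refine Finset.sum_congr rfl fun i _ => Finset.sum_congr rfl fun j _ => ?_
    rw [h1, Matrix.mul_assoc, diagonal_mul, diagonal_mul, diagonal_mul]
    linear_combination (Real.sqrt (lam i) * (shrink lam σ * Uᵀ) i j) ^ 2 * hsq i
  have e3 : ‖W.2 * diagonal (fun i => Real.sqrt (lam i))‖ ^ 2
      = ‖U * shrink lam σ * diagonal (fun i => Real.sqrt (lam i))‖ ^ 2 := by
    rw [frobenius_norm_sq_eq_sum, frobenius_norm_sq_eq_sum]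
    refine Finset.sum_congr rfl fun i _ => Finset.sum_congr rfl fun j _ => ?_
    rw [h2, mul_diagonal, mul_diagonal, mul_diagonal]
    linear_combination (Real.sqrt (lam j) * (U * shrink lam σ) i j) ^ 2 * hsq j
  rw [objective, e1, e2, e3, objective]

theorem objective_coercive {c : ℝ} (hc : 0 ≤ c) (hlam : ∀ i, c ≤ lam i) (W : Weights m k) :
    c * ‖W‖ ^ 2 ≤ objective X lam W := by
  have h1 : c * ‖W.1‖ ^ 2 ≤ ‖diagonal (fun i => Real.sqrt (lam i)) * W.1‖ ^ 2 := by
    rw [frobenius_norm_sq_eq_sum, frobenius_norm_sq_eq_sum, Finset.mul_sum]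
    refine Finset.sum_le_sum fun i _ => ?_
    rw [Finset.mul_sum]
    refine Finset.sum_le_sum fun j _ => ?_
    rw [diagonal_mul, mul_pow, Real.sq_sqrt (hc.trans (hlam i))]
    exact mul_le_mul_of_nonneg_right (hlam i) (sq_nonneg _)
  have h2 : c * ‖W.2‖ ^ 2 ≤ ‖W.2 * diagonal (fun i => Real.sqrt (lam i))‖ ^ 2 := by
    rw [frobenius_norm_sq_eq_sum, frobenius_norm_sq_eq_sum, Finset.mul_sum]
    refine Finset.sum_le_sum fun i _ => ?_
    rw [Finset.mul_sum]
    refine Finset.sum_le_sum fun j _ => ?_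
    rw [mul_diagonal, mul_pow, Real.sq_sqrt (hc.trans (hlam j)), mul_comm]
    exact mul_le_mul_of_nonneg_left (hlam j) (sq_nonneg _)
  have h3 : 0 ≤ 1 / (n : ℝ) * ‖X - W.2 * W.1 * X‖ ^ 2 := by positivity
  have h4 : 0 ≤ c * ‖W.1‖ ^ 2 := by positivity
  have h5 : 0 ≤ c * ‖W.2‖ ^ 2 := by positivity
  -- The norm of a pair is the maximum of the two norms, so one penalty suffices for the bound and
  -- the other is dropped as nonnegative.
  rw [objective, Prod.norm_def]
  rcases max_choice ‖W.1‖ ‖W.2‖ with h | h <;> rw [h] <;> linarith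

theorem exists_isMinOn_objective (hk : 0 < k) (hpos : ∀ i, 0 < lam i) (hmono : StrictMono lam) :
    ∃ W, IsMinOn (objective X lam) Set.univ W :=
  have : ProperSpace (Weights m k) := FiniteDimensional.proper_real _
  exists_isMinOn_of_coercive (contDiff_objective X lam).continuous (hpos ⟨0, hk⟩)
    (objective_coercive X (hpos _).le fun i => hmono.monotone (Nat.zero_le i.1))

end Minimum

theorem isOrderedAxisAligned_of_curvature_nonneg {m n k : ℕ} {X : Matrix (Fin m) (Fin n) ℝ}
    {U : Matrix (Fin m) (Fin k) ℝ} {σ lam : Fin k → ℝ} (hU : IsTopEigensystem (empCov X) U σ)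
    (hpos : ∀ i, 0 < lam i) (hmono : StrictMono lam) (hlt : ∀ i l, lam i < σ l ^ 2)
    {W : Weights m k} (hst : IsStationary (objective X lam) W)
    (h : ∀ V, 0 ≤ curvature (empCov X) lam W V) : IsOrderedAxisAligned lam σ U W := by
  have hC := empCov_transpose X
  obtain ⟨A, B⟩ := W
  obtain ⟨rfl, ν, hA⟩ := exists_isEigenEncoder_of_slope_eq_zero hC
    (dotProduct_empCov_mulVec_nonneg X) hpos hmono.injective ((isStationary_iff X hpos _).1 hst)
  exact hA.isOrderedAxisAligned hC hU hpos hmono hlt h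

end LAE

theorem theorem3 (m n k : ℕ) (hk : 0 < k) (hkm : k < m)
    (X : Matrix (Fin m) (Fin n) ℝ) (U : Matrix (Fin m) (Fin k) ℝ) (σ lam : Fin k → ℝ)
    (hU : LAE.IsTopEigensystem (LAE.empCov X) U σ)
    (hlam_pos : ∀ i, 0 < lam i) (hlam_mono : StrictMono lam)
    (hlam_lt : lam ⟨k - 1, Nat.sub_one_lt_of_lt hk⟩ < σ ⟨k - 1, Nat.sub_one_lt_of_lt hk⟩ ^ 2) :
    -- the minimum is attained, and exactly at the ordered, axis-aligned points
    (∃ W, IsMinOn (LAE.objective X lam) Set.univ W) ∧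
    (∀ W, IsMinOn (LAE.objective X lam) Set.univ W ↔ LAE.IsOrderedAxisAligned lam σ U W) ∧
    -- every other stationary point is a strict saddle
    (∀ W, LAE.IsStationary (LAE.objective X lam) W → ¬ LAE.IsOrderedAxisAligned lam σ U W →
      LAE.IsStrictSaddle (LAE.objective X lam) W) ∧
    -- every local minimum is a global one
    (∀ W, IsLocalMin (LAE.objective X lam) W → IsMinOn (LAE.objective X lam) Set.univ W) := by
  have hlt (i l : Fin k) : lam i < σ l ^ 2 := by
    have hi : i ≤ ⟨k - 1, Nat.sub_one_lt_of_lt hk⟩ := Nat.le_sub_one_of_lt i.2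
    have hl : l ≤ ⟨k - 1, Nat.sub_one_lt_of_lt hk⟩ := Nat.le_sub_one_of_lt l.2
    exact ((hlam_mono.monotone hi).trans_lt hlam_lt).trans_le (hU.strictAnti.antitone hl)
  have hcd := LAE.contDiff_objective X lam
  have hloc (W) (hW : IsLocalMin (LAE.objective X lam) W) :
      LAE.IsOrderedAxisAligned lam σ U W := by
    have hst : LAE.IsStationary (LAE.objective X lam) W := LAE.isStationary_of_isLocalMin hcd hW
    exact LAE.isOrderedAxisAligned_of_curvature_nonneg hU hlam_pos hlam_mono hlt hst
      (LAE.curvature_nonneg_of_isLocalMin X hlam_pos hst hW)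
  obtain ⟨W₀, hW₀⟩ := LAE.exists_isMinOn_objective X hk hlam_pos hlam_mono
  have hmin (W) (hW : LAE.IsOrderedAxisAligned lam σ U W) :
      IsMinOn (LAE.objective X lam) Set.univ W := by
    -- Some minimizer `W₀` exists and is itself ordered and axis-aligned, so `W` has the same,
    -- minimal, value.
    intro V hV
    have h0 := hloc W₀ (hW₀.isLocalMin Filter.univ_mem)
    change LAE.objective X lam W ≤ LAE.objective X lam V
    rw [LAE.objective_eq_of_isOrderedAxisAligned X U hW,
      ← LAE.objective_eq_of_isOrderedAxisAligned X U h0]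
    exact hW₀ hV
  refine ⟨⟨W₀, hW₀⟩, fun W => ⟨fun h => hloc W (h.isLocalMin Filter.univ_mem), hmin W⟩,
    fun W hst hW => ⟨hst, hcd.contDiffAt,
      LAE.not_isLocalMax_of_isStationary hk (hk.trans hkm) X hlam_pos hst, ?_⟩,
    fun W h => hmin W (hloc W h)⟩
  by_contra! hneg
  refine hW (LAE.isOrderedAxisAligned_of_curvature_nonneg hU hlam_pos hlam_mono hlt hst fun V => ?_)
  have h1 := (hneg V).trans_eq (LAE.hessian_objective X hlam_pos W V)
  linarith
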